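/- Let $X$ be an analytic normed plane, i.e. a $2$-dimensional real normed space whose norm is a real analytic function on $X\setminus\{0\}$, and let $z\in X$ be non-zero. Let $L>0$, let $\mathbb{T}=\mathbb{R}/L\mathbb{Z}$, and let $f:\mathbb{T}\to X$ be an analytic map that is a bijection onto the circle $S_{\|z\|}[0]=\{x\in X:\|x\|=\|z\|\}$, with $f(0)=z$ and $\|f'(t)\|=1$ for all $t\in\mathbb{T}$. (Maps on $\mathbb{T}$ and on $U\times\mathbb{T}$, for $U\subset X$ open, are analytic if their lifts to $\mathbb{R}$ and $U\times\mathbb{R}$ are; $L$ is necessarily the length of the circle $S_{\|z\|}[0]$ measured in the norm of $X$.) Then there exists a unique continuous map $r_z:X\times\mathbb{T}\to X$ such that (i) $r_z(z,t)=f(t)$ for all $t\in\mathbb{T}$; (ii) $r_z(x,0)=x$ for all $x\in X$; (iii) $\|r_z(x,t)\|=\|x\|$ and $\|r_z(x,t)-r_z(z,t)\|=\|x-z\|$ for all $x\in X$ and $t\in\mathbb{T}$. Furthermore, $r_z$ has the following properties: (1) $r_z$ is analytic on $(X\setminus\operatorname{span}\{z\})\times\mathbb{T}$. (2) For all $x,y\in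 X\setminus\operatorname{span}\{z\}$ and all $t\in\mathbb{T}$, the points $r_z(x,t),r_z(y,t)$ lie in $X\setminus\operatorname{span}\{f(t)\}$, and $x,y$ lie in the same connected component of $X\setminus\operatorname{span}\{z\}$ if and only if $r_z(x,t),r_z(y,t)$ lie in the same connected component of $X\setminus\operatorname{span}\{f(t)\}$. (3) For every $t\in\mathbb{T}$, $r_z(\cdot,t)$ is a homeomorphism from $X$ to $X$. (4) For every non-zero $x\in X$, $r_z(x,\cdot)$ is a homeomorphism between $\mathbb{T}$ and the circle $S_{\|x\|}[0]$. (5) For all $x\in X$ and $t\in\mathbb{T}$, $r_z(x,t^*)=-r_z(x,t)$, where $t^*=t+L/2$ is the point of $\mathbb{T}$ antipodal to $t$. -/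

import Mathlib

/-- A real normed space is analytic if its norm is a real analytic function away from the origin. -/
def IsAnalyticNormedSpace (X : Type*) [NormedAddCommGroup X] [NormedSpace ℝ X] : Prop :=
  AnalyticOnNhd ℝ (fun x : X => ‖x‖) {0}ᶜ

/-- `f : ℝ / L ℤ → X` is an analytic parametrisation, at unit speed and starting from `z`, of the
circle of radius `‖z‖` about the origin. Analyticity and the derivative on `ℝ / L ℤ` are those of
the `L`-periodic lift to `ℝ`, the charts of `ℝ / L ℤ` being local inverses of `ℝ → ℝ / L ℤ`. -/
structure IsUnitSpeedCircle {X : Type*} [NormedAddCommGroup X] [NormedSpace ℝ X] {L : ℝ}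
    (z : X) (f : AddCircle L → X) : Prop where
  analytic : AnalyticOnNhd ℝ (fun s : ℝ => f (s : AddCircle L)) Set.univ
  bijective : Set.BijOn f Set.univ (Metric.sphere 0 ‖z‖)
  map_zero : f 0 = z
  speed : ∀ s : ℝ, ‖deriv (fun u : ℝ => f (u : AddCircle L)) s‖ = 1

/-- `r` is a `z`-rotation along `f`: a continuous map `X × ℝ / L ℤ → X` which moves `z` along `f`,
is the identity at time `0`, and preserves the distances to `0` and to the moving point `z`. -/
structure IsZRotation {X : Type*} [NormedAddCommGroup X] [NormedSpace ℝ X] {L : ℝ}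
    (z : X) (f : AddCircle L → X) (r : X × AddCircle L → X) : Prop where
  continuous : Continuous r
  apply_self : ∀ t : AddCircle L, r (z, t) = f t
  apply_zero : ∀ x : X, r (x, 0) = x
  norm_eq : ∀ (x : X) (t : AddCircle L), ‖r (x, t)‖ = ‖x‖
  norm_sub_eq : ∀ (x : X) (t : AddCircle L), ‖r (x, t) - r (z, t)‖ = ‖x - z‖

/-- `x` and `y` lie in the same connected component of `X \ span {w}`
(in particular, neither lies in `span {w}`). -/
def SameSide {X : Type*} [NormedAddCommGroup X] [NormedSpace ℝ X] (w x y : X) : Prop :=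
  y ∈ connectedComponentIn ((Submodule.span ℝ {w} : Submodule ℝ X) : Set X)ᶜ x

/-! An analytic norm is strictly convex: a segment in the unit sphere would, by the identity
theorem, force the norm to equal 1 on a whole line. In a strictly convex plane, the distances of a
point to 0 and to z, together with its side of the line through 0 and z, determine the point
(`IsRotated.unique`). An intermediate value argument on a half-circle supplies such a point when z
is replaced by any z' of the same norm (`IsRotated.exists_isRotated`). Taking z' = f(t) defines the
rotation; it is continuous because the defining relation is closed, has a unique solution and stays
locally in a compact ball. Conversely, a continuous z-rotation cannot change side over time, so it
is this one.

Bijectivity in x and in t comes from two symmetries of `IsRotated`, `symm` and `exchange`.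
Analyticity off span{z} follows from the inverse function theorem, since circles about 0 and f(t)
meet transversally off their line of centres. Finally, f and -f solve the same autonomous equation,
so f(t + L/2) = -f(t), and the rotation inherits this. -/

open Set Filter Topology

/-! ### Signed area and the two sides of a line. -/

section PlaneArea

variable {X : Type*} [NormedAddCommGroup X] [NormedSpace ℝ X]

/-- The signed area form on a plane `X` obtained from linear coordinates on `X`. -/
def planeArea (e : X ≃L[ℝ] ℝ × ℝ) (x y : X) : ℝ := (e x).1 * (e y).2 - (e x).2 * (e y).1

variable (e : X ≃L[ℝ] ℝ × ℝ)

theorem planeArea_swap (x y : X) : planeArea e y x = -planeArea e x y := by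
  simp only [planeArea]; ring

@[simp] theorem planeArea_self (x : X) : planeArea e x x = 0 := by
  simp only [planeArea]; ring

theorem planeArea_add_right (x y w : X) :
    planeArea e x (y + w) = planeArea e x y + planeArea e x w := by
  simp only [planeArea, map_add, Prod.fst_add, Prod.snd_add]; ring

theorem planeArea_smul_right (a : ℝ) (x y : X) :
    planeArea e x (a • y) = a * planeArea e x y := by
  simp only [planeArea, map_smul, Prod.smul_fst, Prod.smul_snd, smul_eq_mul]; ring

theorem planeArea_sub_right (x y w : X) :
    planeArea e x (y - w) = planeArea e x y - planeArea e x w := by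
  simp only [planeArea, map_sub, Prod.fst_sub, Prod.snd_sub]; ring

theorem planeArea_neg_neg (x y : X) : planeArea e (-x) (-y) = planeArea e x y := by
  simp only [planeArea, map_neg, Prod.fst_neg, Prod.snd_neg]; ring

theorem planeArea_reflect (x y : X) :
    planeArea (e.trans (ContinuousLinearEquiv.prodComm ℝ ℝ ℝ)) x y = -planeArea e x y := by
  simp [planeArea]

/-- Cramer's rule in symmetric form; it supplies the explicit coefficients whenever one vector is
expressed through two others. -/
theorem planeArea_cyclic (x y w : X) :
    planeArea e x y • w + planeArea e y w • x + planeArea e w x • y = 0 := by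
  apply e.injective
  ext <;> simp [planeArea] <;> ring

theorem planeArea_eq_zero_iff {x : X} (hx : x ≠ 0) (y : X) :
    planeArea e x y = 0 ↔ y ∈ Submodule.span ℝ {x} := by
  rw [Submodule.mem_span_singleton]
  constructor
  · intro h
    have hx' : ¬((e x).1 = 0 ∧ (e x).2 = 0) := fun h' =>
      hx (e.injective (by rw [map_zero]; exact Prod.ext h'.1 h'.2))
    have hxx : (e x).1 ^ 2 + (e x).2 ^ 2 ≠ 0 := fun h' =>
      hx' ⟨by nlinarith [sq_nonneg (e x).1, sq_nonneg (e x).2],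
        by nlinarith [sq_nonneg (e x).1, sq_nonneg (e x).2]⟩
    refine ⟨((e x).1 * (e y).1 + (e x).2 * (e y).2) / ((e x).1 ^ 2 + (e x).2 ^ 2),
      e.injective ?_⟩
    simp only [planeArea] at h
    ext
    · simp only [map_smul, Prod.smul_fst, smul_eq_mul]
      field_simp
      linear_combination (e x).2 * h
    · simp only [map_smul, Prod.smul_snd, smul_eq_mul]
      field_simp
      linear_combination (-(e x).1) * h
  · rintro ⟨a, rfl⟩
    rw [planeArea_smul_right, planeArea_self, mul_zero]

theorem exists_planeArea_eq {x : X} (hx : x ≠ 0) (a : ℝ) : ∃ y, planeArea e x y = a := by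
  by_contra! h
  obtain ⟨y, hy⟩ : ∃ y, planeArea e x y ≠ 0 := by
    by_contra! h0
    apply hx
    apply e.injective
    have h1 := h0 (e.symm (1, 0))
    have h2 := h0 (e.symm (0, 1))
    simp [planeArea] at h1 h2
    ext <;> simp [h1, h2]
  exact h ((a / planeArea e x y) • y) (by rw [planeArea_smul_right]; field_simp)

@[fun_prop]
theorem Continuous.planeArea {T : Type*} [TopologicalSpace T] {u v : T → X}
    (hu : Continuous u) (hv : Continuous v) : Continuous fun t => planeArea e (u t) (v t) := by
  unfold _root_.planeArea
  fun_prop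

/-- The components of the complement are the two open half-planes: each is convex, and a connected
set meeting both would contain a zero of the area. -/
theorem sameSide_iff_planeArea {w : X} (hw : w ≠ 0) (x y : X) :
    SameSide w x y ↔ 0 < planeArea e w x * planeArea e w y := by
  have hmem : ∀ v : X, v ∈ ((Submodule.span ℝ {w} : Submodule ℝ X) : Set X)ᶜ ↔
      planeArea e w v ≠ 0 := fun v => by
    rw [mem_compl_iff, SetLike.mem_coe, ← planeArea_eq_zero_iff e hw]
  have hc : Continuous fun v => planeArea e w x * planeArea e w v := by fun_prop
  constructor
  · intro h
    have hsub := connectedComponentIn_subset ((Submodule.span ℝ {w} : Submodule ℝ X) : Set X)ᶜ x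
    have hx : x ∈ ((Submodule.span ℝ {w} : Submodule ℝ X) : Set X)ᶜ :=
      connectedComponentIn_nonempty_iff.1 ⟨y, h⟩
    have hx0 := (hmem x).1 hx
    by_contra hneg
    obtain ⟨v, hv, hv0⟩ := isPreconnected_connectedComponentIn.intermediate_value h
      (mem_connectedComponentIn hx) hc.continuousOn
      (show (0 : ℝ) ∈ _ from ⟨not_lt.1 hneg, mul_self_nonneg _⟩)
    exact (hmem v).1 (hsub hv) ((mul_eq_zero.1 hv0).resolve_left hx0)
  · intro h
    have hx0 : planeArea e w x ≠ 0 := left_ne_zero_of_mul h.ne'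
    have hconv : Convex ℝ {v | 0 < planeArea e w x * planeArea e w v} := by
      intro u hu v hv a b ha hb hab
      simp only [mem_ofPred_eq, planeArea_add_right, planeArea_smul_right] at hu hv ⊢
      have : planeArea e w x * (a * planeArea e w u + b * planeArea e w v) =
        a * (planeArea e w x * planeArea e w u) + b * (planeArea e w x * planeArea e w v) := by
        ring
      rw [this]
      rcases ha.eq_or_lt with rfl | ha
      · rw [zero_add] at hab; subst hab; linarith
      · have := mul_pos ha hu
        have := mul_nonneg hb hv.le
        linarith
    refine hconv.isPreconnected.subset_connectedComponentIn ?_ ?_ h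
    · exact mul_self_pos.2 hx0
    · intro v hv
      exact (hmem v).2 (right_ne_zero_of_mul (ne_of_gt hv))

end PlaneArea

/-! ### Analytic norms are strictly convex. -/

section StrictConvex

variable {X : Type*} [NormedAddCommGroup X] [NormedSpace ℝ X]

theorem IsAnalyticNormedSpace.strictConvexSpace (hX : IsAnalyticNormedSpace X) :
    StrictConvexSpace ℝ X := by
  refine StrictConvexSpace.of_norm_add_ne_two fun x y hx hy hxy hadd => ?_
  have hne : ∀ t : ℝ, x + t • (y - x) ≠ 0 := by
    intro t ht
    have h1 : (1 - t) • x = (-t) • y := by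
      rw [← sub_eq_zero, ← ht]; module
    have h2 : |1 - t| = |t| := by
      have := congrArg norm h1
      simpa [norm_smul, hx, hy] using this
    have h3 : t = 1 / 2 := by
      rcases abs_eq_abs.1 h2 with h | h <;> linarith
    have h4 : x + y = 0 := by
      have : x + y = (2 : ℝ) • (x + t • (y - x)) := by rw [h3]; module
      rw [this, ht, smul_zero]
    rw [h4, norm_zero] at hadd
    norm_num at hadd
  have hg : AnalyticOnNhd ℝ (fun t : ℝ => ‖x + t • (y - x)‖) univ := by
    intro t _
    have h1 : AnalyticAt ℝ (fun t : ℝ => x + t • (y - x)) t := by fun_prop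
    exact AnalyticAt.fun_comp (hX _ (hne t)) h1
  have hle : ∀ t ∈ Icc (0 : ℝ) 1, ‖x + t • (y - x)‖ ≤ 1 := by
    intro t ht
    have : x + t • (y - x) = (1 - t) • x + t • y := by module
    rw [this]
    refine (norm_add_le _ _).trans ?_
    rw [norm_smul, norm_smul, hx, hy, Real.norm_of_nonneg ht.1,
      Real.norm_of_nonneg (sub_nonneg.2 ht.2)]
    linarith
  -- The points at t and 1 - t sum to x + y, of norm 2, and each has norm at most 1.
  have heq : ∀ t ∈ Icc (0 : ℝ) 1, ‖x + t • (y - x)‖ = 1 := by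
    intro t ht
    refine le_antisymm (hle t ht) ?_
    have h2 := hle (1 - t) ⟨by linarith [ht.2], by linarith [ht.1]⟩
    have h3 : x + y = (x + t • (y - x)) + (x + (1 - t) • (y - x)) := by module
    have h4 := norm_add_le (x + t • (y - x)) (x + (1 - t) • (y - x))
    rw [← h3, hadd] at h4
    linarith
  have hev : (fun t : ℝ => ‖x + t • (y - x)‖) =ᶠ[𝓝 (1 / 2)] fun _ => 1 := by
    filter_upwards [Icc_mem_nhds (show (0 : ℝ) < 1 / 2 by norm_num)
      (show (1 / 2 : ℝ) < 1 by norm_num)] with t ht using heq t ht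
  have hall := hg.eq_of_eventuallyEq (fun _ _ => analyticAt_const) hev
  have hd : 0 < ‖y - x‖ := norm_pos_iff.2 (sub_ne_zero.2 hxy.symm)
  -- At this parameter the displacement from the unit vector x has norm 3, so the point has norm at
  -- least 2.
  have hfar := congrFun hall (3 / ‖y - x‖)
  have h5 := norm_sub_norm_le ((3 / ‖y - x‖) • (y - x)) (-x)
  rw [sub_neg_eq_add, add_comm _ x, hfar, norm_neg, hx, norm_smul,
    Real.norm_of_nonneg (by positivity), div_mul_cancel₀ _ hd.ne'] at h5
  norm_num at h5

end StrictConvex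

/-! ### Two circles meet at most once on each side of their line of centres. -/

section CircleIntersection

variable {X : Type*} [NormedAddCommGroup X] [NormedSpace ℝ X] [StrictConvexSpace ℝ X]

/-- If the segment from `0` to `w₁` meets the segment from `p` to `w₂`, both pairs of distances
to `0` and `p` can agree only if `w₁ = w₂`. -/
theorem eq_of_norm_eq_of_segments_meet {p w₁ w₂ : X} {s t : ℝ} (hs : 0 < s) (hs1 : s ≤ 1)
    (ht : 0 ≤ t) (ht1 : t ≤ 1) (hmeet : s • w₁ = p + t • (w₂ - p)) (h0 : ‖w₁‖ = ‖w₂‖)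
    (hp : ‖w₁ - p‖ = ‖w₂ - p‖) : w₁ = w₂ := by
  -- Go from 0 to w₂ and from p to w₁ through the meeting point. With the two norm equalities, the
  -- second triangle inequality forces equality in the first.
  have e2 : s • w₁ + (1 - t) • (w₂ - p) = w₂ := by rw [hmeet]; module
  have e1 : (1 - s) • w₁ + t • (w₂ - p) = w₁ - p := by
    rw [sub_smul, one_smul, hmeet]; module
  have n2 := norm_add_le (s • w₁) ((1 - t) • (w₂ - p))
  have n1 := norm_add_le ((1 - s) • w₁) (t • (w₂ - p))
  have hray : SameRay ℝ (s • w₁) ((1 - t) • (w₂ - p)) := by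
    rw [sameRay_iff_norm_add]
    refine le_antisymm n2 ?_
    rw [e1, norm_smul, norm_smul, Real.norm_of_nonneg (sub_nonneg.2 hs1),
      Real.norm_of_nonneg ht] at n1
    rw [e2, norm_smul, norm_smul, Real.norm_of_nonneg (sub_nonneg.2 ht1),
      Real.norm_of_nonneg hs.le]
    linarith
  have hray2 : SameRay ℝ (s • w₁) w₂ := by
    have := (SameRay.refl (R := ℝ) (s • w₁)).add_right hray
    rwa [e2] at this
  have hray1 := hray2.pos_smul_left (inv_pos.2 hs)
  rw [inv_smul_smul₀ hs.ne'] at hray1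
  exact (sameRay_iff_of_norm_eq h0).1 hray1

/-- If `w₁` lies in the triangle with vertices `0`, `p` and `w₂`, both pairs of distances
to `0` and `p` can agree only if `w₁ = w₂`. -/
theorem eq_of_norm_eq_of_mem_triangle {p w₁ w₂ : X} {s t : ℝ} (hs : 0 < s) (ht : 0 ≤ t)
    (hst : s + t ≤ 1) (hw : w₁ = s • w₂ + t • p) (h0 : ‖w₁‖ = ‖w₂‖)
    (hp : ‖w₁ - p‖ = ‖w₂ - p‖) : w₁ = w₂ := by
  have hr : 0 < s + t := by linarith
  -- The ray from 0 through w₁ leaves the triangle at c, on the side from w₂ to p. The triangle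
  -- inequality for w₁, c, p forces equality in the one for 0, w₂, c.
  set c := (s + t)⁻¹ • w₁ with hc
  have ec : w₂ + (t / (s + t)) • (p - w₂) = c := by
    rw [hc, hw]
    match_scalars <;> field_simp
    ring
  have e1 : ((s + t)⁻¹ - 1) • (-w₁) + (s / (s + t)) • (w₂ - p) = w₁ - p := by
    have : ((s + t)⁻¹ - 1) • (-w₁) = w₁ - c := by rw [hc]; module
    rw [this, ← ec]
    match_scalars <;> field_simp <;> ring
  have hinv : 1 ≤ (s + t)⁻¹ := (one_le_inv₀ hr).2 hst
  have n2 := norm_add_le w₂ ((t / (s + t)) • (p - w₂))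
  have n1 := norm_add_le (((s + t)⁻¹ - 1) • (-w₁)) ((s / (s + t)) • (w₂ - p))
  have hsum : s / (s + t) = 1 - t / (s + t) := by field_simp; ring
  have hray : SameRay ℝ w₂ ((t / (s + t)) • (p - w₂)) := by
    rw [sameRay_iff_norm_add]
    refine le_antisymm n2 ?_
    rw [e1, norm_smul, norm_smul, norm_neg, Real.norm_of_nonneg (by linarith),
      Real.norm_of_nonneg (by positivity), hp, hsum] at n1
    rw [ec, hc, norm_smul, norm_smul, norm_sub_rev p, Real.norm_of_nonneg (by positivity),
      Real.norm_of_nonneg (by positivity)]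
    linarith
  have hray2 : SameRay ℝ w₂ c := by
    have := (SameRay.refl (R := ℝ) w₂).add_right hray
    rwa [ec] at this
  have hray1 := hray2.pos_smul_right hr
  rw [hc, smul_inv_smul₀ hr.ne'] at hray1
  exact (sameRay_iff_of_norm_eq h0).1 hray1.symm

variable (e : X ≃L[ℝ] ℝ × ℝ)

/-- Up to swapping the points, b w₁ = a w₂ + d p with a, b > 0 and d ≥ 0. If b ≤ a + d the segments
meet; if a + d ≤ b the point w₁ lies in the triangle. -/
theorem eq_of_norm_eq_of_planeArea_pos {p w₁ w₂ : X} (h₁ : 0 < planeArea e p w₁)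
    (h₂ : 0 < planeArea e p w₂) (h0 : ‖w₁‖ = ‖w₂‖) (hp : ‖w₁ - p‖ = ‖w₂ - p‖) : w₁ = w₂ := by
  wlog hD : 0 ≤ planeArea e w₁ w₂ generalizing w₁ w₂
  · refine (this h₂ h₁ h0.symm hp.symm ?_).symm
    rw [planeArea_swap]
    linarith
  have hcyc := planeArea_cyclic e p w₁ w₂
  rw [planeArea_swap e p w₂] at hcyc
  generalize planeArea e p w₁ = a at *
  generalize planeArea e p w₂ = b at *
  generalize planeArea e w₁ w₂ = d at *
  have hrel : a • w₂ = b • w₁ - d • p := by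
    rw [← sub_eq_zero, ← hcyc]; module
  rcases le_total b (d + a) with h | h
  · have hda : 0 < d + a := by linarith
    refine eq_of_norm_eq_of_segments_meet (p := p) (s := b / (d + a)) (t := a / (d + a))
      (by positivity) ((div_le_one hda).2 h) (by positivity) ((div_le_one hda).2 (by linarith))
      ?_ h0 hp
    have : p + (a / (d + a)) • (w₂ - p) = (d + a)⁻¹ • (a • w₂ + d • p) := by
      match_scalars <;> field_simp
      ring
    rw [this, hrel]
    match_scalars <;> field_simp
    ring
  · refine eq_of_norm_eq_of_mem_triangle (p := p) (s := a / b) (t := d / b)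
      (by positivity) (by positivity) (by rw [← add_div, div_le_one h₂]; linarith) ?_ h0 hp
    have : (a / b) • w₂ + (d / b) • p = b⁻¹ • (a • w₂ + d • p) := by
      match_scalars <;> field_simp
    rw [this, hrel]
    match_scalars <;> field_simp
    ring

theorem eq_of_norm_eq_of_planeArea_mul_pos {p w₁ w₂ : X}
    (h : 0 < planeArea e p w₁ * planeArea e p w₂) (h0 : ‖w₁‖ = ‖w₂‖)
    (hp : ‖w₁ - p‖ = ‖w₂ - p‖) : w₁ = w₂ := by
  rcases mul_pos_iff.1 h with ⟨h₁, h₂⟩ | ⟨h₁, h₂⟩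
  · exact eq_of_norm_eq_of_planeArea_pos e h₁ h₂ h0 hp
  · refine eq_of_norm_eq_of_planeArea_pos (e.trans (ContinuousLinearEquiv.prodComm ℝ ℝ ℝ))
      (p := p) ?_ ?_ h0 hp <;> rw [planeArea_reflect] <;> linarith

/-- A point with the same distances to `0` and `p` as the point `a • p` of the line through
`0` and `p` coincides with it. -/
theorem eq_smul_of_norm_eq {p w : X} {a : ℝ} (hp : p ≠ 0) (h0 : ‖w‖ = ‖a • p‖)
    (h1 : ‖w - p‖ = ‖a • p - p‖) : w = a • p := by
  have hpp : 0 < ‖p‖ := norm_pos_iff.2 hp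
  have h1' : ‖w - p‖ = |a - 1| * ‖p‖ := by
    rw [h1, ← Real.norm_eq_abs, ← norm_smul]; congr 1; module
  have h0' : ‖w‖ = |a| * ‖p‖ := by rw [h0, norm_smul, Real.norm_eq_abs]
  -- Among 0, p and w, the middle point is 0 if a < 0, w if 0 ≤ a ≤ 1, and p if a ≥ 1; in each case
  -- a triangle inequality is an equality.
  rcases lt_or_ge a 0 with ha | ha
  · have hray : SameRay ℝ w (-p) := by
      rw [sameRay_iff_norm_add, ← sub_eq_add_neg, norm_neg, h1', h0', abs_of_neg ha,
        abs_of_neg (by linarith)]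
      ring
    have hray2 : SameRay ℝ w (a • p) := by
      have := hray.pos_smul_right (neg_pos.2 ha)
      rwa [smul_neg, neg_smul, neg_neg] at this
    exact (sameRay_iff_of_norm_eq h0).1 hray2
  have hray : SameRay ℝ w p := by
    rcases le_total a 1 with ha1 | ha1
    · have : SameRay ℝ w (p - w) := by
        rw [sameRay_iff_norm_add, norm_sub_rev p w, h1', h0', add_sub_cancel, abs_of_nonneg ha,
          abs_of_nonpos (by linarith)]
        ring
      have := (SameRay.refl (R := ℝ) w).add_right this
      rwa [add_sub_cancel] at this
    · have : SameRay ℝ p (w - p) := by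
        rw [sameRay_iff_norm_add, h1', add_sub_cancel, h0', abs_of_nonneg ha,
          abs_of_nonneg (by linarith)]
        ring
      have := (SameRay.refl (R := ℝ) p).add_right this
      rw [add_sub_cancel] at this
      exact this.symm
  exact (sameRay_iff_of_norm_eq h0).1 (hray.nonneg_smul_right ha)

end CircleIntersection

/-! ### The rotated point: uniqueness, existence, continuity. -/

section IsRotated

variable {X : Type*} [NormedAddCommGroup X] [NormedSpace ℝ X]

/-- The point `w` lies with respect to `0` and `z'` as the point `x` does with respect to `0` and
`z`: the distances agree, and so do the sides with respect to the lines through `0`. -/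
structure IsRotated (e : X ≃L[ℝ] ℝ × ℝ) (z z' x w : X) : Prop where
  norm_eq : ‖w‖ = ‖x‖
  norm_sub_eq : ‖w - z'‖ = ‖x - z‖
  planeArea_nonneg : 0 ≤ planeArea e z x * planeArea e z' w

namespace IsRotated

variable {e : X ≃L[ℝ] ℝ × ℝ} {z z' x w : X}

theorem symm (h : IsRotated e z z' x w) : IsRotated e z' z w x :=
  ⟨h.norm_eq.symm, h.norm_sub_eq.symm, by rw [mul_comm]; exact h.planeArea_nonneg⟩

/-- The roles of the centre and of the rotated point can be exchanged. -/
theorem exchange (hz : ‖z'‖ = ‖z‖) (h : IsRotated e z z' x w) : IsRotated e x w z z' := by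
  refine ⟨hz, by rw [norm_sub_rev, h.norm_sub_eq, norm_sub_rev], ?_⟩
  rw [planeArea_swap e z x, planeArea_swap e z' w, neg_mul_neg]
  exact h.planeArea_nonneg

theorem neg (h : IsRotated e z z' x w) : IsRotated e z (-z') x (-w) := by
  refine ⟨by rw [norm_neg, h.norm_eq], ?_, ?_⟩
  · rw [← h.norm_sub_eq, ← norm_neg (w - z')]; congr 1; abel
  · rw [planeArea_neg_neg]; exact h.planeArea_nonneg

/-- If w were a • z', then x would have the distances of a • z to 0 and z, hence equal it and lie on
the line. -/
theorem planeArea_pos [StrictConvexSpace ℝ X] (hz : z ≠ 0) (hzz : ‖z'‖ = ‖z‖)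
    (h : IsRotated e z z' x w) (hx : planeArea e z x ≠ 0) :
    0 < planeArea e z x * planeArea e z' w := by
  have hz' : z' ≠ 0 := by rw [← norm_pos_iff, hzz, norm_pos_iff]; exact hz
  refine h.planeArea_nonneg.lt_of_ne' (mul_ne_zero hx fun hw => hx ?_)
  obtain ⟨a, rfl⟩ := Submodule.mem_span_singleton.1 ((planeArea_eq_zero_iff e hz' w).1 hw)
  have hxa : x = a • z := by
    refine eq_smul_of_norm_eq hz ?_ ?_
    · rw [← h.norm_eq, norm_smul, norm_smul, hzz]
    · have h1 : ∀ v : X, a • v - v = (a - 1) • v := fun v => by module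
      rw [← h.norm_sub_eq, h1, h1, norm_smul, norm_smul, hzz]
  rw [hxa, planeArea_smul_right, planeArea_self, mul_zero]

theorem unique [StrictConvexSpace ℝ X] {w' : X} (hz : z ≠ 0) (hzz : ‖z'‖ = ‖z‖)
    (h : IsRotated e z z' x w) (h' : IsRotated e z z' x w') : w = w' := by
  have hz' : z' ≠ 0 := by rw [← norm_pos_iff, hzz, norm_pos_iff]; exact hz
  by_cases hx : planeArea e z x = 0
  · obtain ⟨a, rfl⟩ := Submodule.mem_span_singleton.1 ((planeArea_eq_zero_iff e hz x).1 hx)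
    have key : ∀ v, IsRotated e z z' (a • z) v → v = a • z' := fun v hv => by
      refine eq_smul_of_norm_eq hz' ?_ ?_
      · rw [hv.norm_eq, norm_smul, norm_smul, hzz]
      · have h1 : ∀ v : X, a • v - v = (a - 1) • v := fun v => by module
        rw [hv.norm_sub_eq, h1, h1, norm_smul, norm_smul, hzz]
    rw [key w h, key w' h']
  · refine eq_of_norm_eq_of_planeArea_mul_pos e (p := z') ?_ (h.norm_eq.trans h'.norm_eq.symm)
      (h.norm_sub_eq.trans h'.norm_sub_eq.symm)
    have h1 := h.planeArea_pos hz hzz hx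
    have h2 := h'.planeArea_pos hz hzz hx
    have h3 := mul_pos h1 h2
    rw [mul_mul_mul_comm] at h3
    exact (mul_pos_iff_of_pos_left (mul_self_pos.2 hx)).1 h3

variable (e) in
-- Along the half-circle of radius ‖x‖ on the prescribed side, the distance to z' runs from |‖x‖ -
-- ‖z‖| to ‖x‖ + ‖z‖, and ‖x - z‖ lies between.
theorem exists_isRotated (hz : z ≠ 0) (hzz : ‖z'‖ = ‖z‖) (x : X) :
    ∃ w, IsRotated e z z' x w := by
  have hz' : z' ≠ 0 := by rw [← norm_pos_iff, hzz, norm_pos_iff]; exact hz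
  -- The vector q selects the side; if x lies on the line, either side will do.
  obtain ⟨q, hq0, hq⟩ : ∃ q, planeArea e z' q ≠ 0 ∧ 0 ≤ planeArea e z x * planeArea e z' q := by
    by_cases hx : planeArea e z x = 0
    · obtain ⟨q, hq⟩ := exists_planeArea_eq e hz' 1
      exact ⟨q, by simp [hq], by simp [hx]⟩
    · obtain ⟨q, hq⟩ := exists_planeArea_eq e hz' (planeArea e z x)
      exact ⟨q, by rwa [hq], by rw [hq]; exact mul_self_nonneg _⟩
  set u : ℝ → X := fun s => Real.cos s • z' + Real.sin s • q with hu
  have hu0 : ∀ s, u s ≠ 0 := by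
    intro s hs
    have h1 : Real.sin s = 0 := by
      have : planeArea e z' (u s) = 0 := by rw [hs]; simp [planeArea]
      simp only [hu, planeArea_add_right, planeArea_smul_right, planeArea_self, mul_zero,
        zero_add] at this
      exact (mul_eq_zero.1 this).resolve_right hq0
    have h2 : Real.cos s = 0 := by
      simp only [hu, h1, zero_smul, add_zero] at hs
      exact (smul_eq_zero.1 hs).resolve_right hz'
    have := Real.sin_sq_add_cos_sq s
    rw [h1, h2] at this
    norm_num at this
  have hun : ∀ s, ‖u s‖ ≠ 0 := fun s => norm_ne_zero_iff.2 (hu0 s)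
  set γ : ℝ → X := fun s => (‖x‖ / ‖u s‖) • u s with hγ
  have huc : Continuous u := by fun_prop
  have hγc : Continuous γ := (continuous_const.div huc.norm hun).smul huc
  have hnorm : ∀ s, ‖γ s‖ = ‖x‖ := fun s => by
    rw [hγ, norm_smul, norm_div, norm_norm, norm_norm, div_mul_cancel₀ _ (hun s)]
  have hρ : ‖z'‖ ≠ 0 := norm_ne_zero_iff.2 hz'
  have hstart : ‖γ 0 - z'‖ ≤ ‖x - z‖ := by
    have : γ 0 - z' = (‖x‖ / ‖z'‖ - 1) • z' := by simp [hγ, hu, sub_smul]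
    rw [this, norm_smul, div_sub_one hρ, norm_div, norm_norm, div_mul_cancel₀ _ hρ, hzz]
    exact abs_norm_sub_norm_le _ _
  have hend : ‖x - z‖ ≤ ‖γ Real.pi - z'‖ := by
    have : γ Real.pi - z' = (-(‖x‖ / ‖z'‖ + 1)) • z' := by
      simp only [hγ, hu, Real.cos_pi, Real.sin_pi, zero_smul, add_zero, neg_smul, one_smul,
        norm_neg]
      module
    rw [this, norm_smul, norm_neg, Real.norm_of_nonneg (by positivity), add_mul,
      div_mul_cancel₀ _ hρ, one_mul, hzz]
    exact norm_sub_le _ _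
  obtain ⟨s, hs, hs'⟩ := intermediate_value_Icc Real.pi_pos.le
    ((hγc.sub continuous_const).norm.continuousOn) ⟨hstart, hend⟩
  refine ⟨γ s, hnorm s, hs', ?_⟩
  simp only [hγ, hu, planeArea_add_right, planeArea_smul_right, planeArea_self, mul_zero,
    zero_add]
  rw [mul_left_comm, mul_left_comm (planeArea e z x)]
  exact mul_nonneg (by positivity) (mul_nonneg (Real.sin_nonneg_of_mem_Icc hs) hq)

/-- The rotated point depends continuously on the data. -/
theorem continuous [StrictConvexSpace ℝ X] [ProperSpace X] {T : Type*} [TopologicalSpace T]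
    {z z' x w : T → X} (hz : ∀ t, z t ≠ 0) (hzz : ∀ t, ‖z' t‖ = ‖z t‖) (hzc : Continuous z)
    (hzc' : Continuous z') (hx : Continuous x)
    (h : ∀ t, IsRotated e (z t) (z' t) (x t) (w t)) : Continuous w := by
  rw [continuous_iff_continuousAt]
  intro t₀
  -- Near t₀ the values stay in a compact ball, and any cluster point satisfies the closed relation
  -- at t₀, whose solution is unique.
  refine (isCompact_closedBall (0 : X) (‖x t₀‖ + 1)).le_nhds_of_unique_clusterPt ?_ ?_
  · have : ∀ᶠ t in 𝓝 t₀, ‖x t‖ < ‖x t₀‖ + 1 :=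
      hx.norm.continuousAt.eventually_lt continuousAt_const (by simp)
    rw [mem_map]
    filter_upwards [this] with t ht
    rw [mem_preimage, mem_closedBall_zero_iff, (h t).norm_eq]
    exact ht.le
  · intro v _ hv
    have hv' : MapClusterPt (t₀, v) (𝓝 t₀) fun t => (t, w t) := by
      rw [((𝓝 t₀).basis_sets.prod_nhds (𝓝 v).basis_sets).mapClusterPt_iff_frequently]
      rintro ⟨A, B⟩ ⟨hA, hB⟩
      exact ((mapClusterPt_iff_frequently.1 hv B hB).and_eventually hA).mono
        fun t ht => ⟨ht.2, ht.1⟩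
    have hclosed : IsClosed {q : T × X | IsRotated e (z q.1) (z' q.1) (x q.1) q.2} := by
      have : {q : T × X | IsRotated e (z q.1) (z' q.1) (x q.1) q.2} =
          {q | ‖q.2‖ = ‖x q.1‖} ∩ {q | ‖q.2 - z' q.1‖ = ‖x q.1 - z q.1‖} ∩
          {q | 0 ≤ planeArea e (z q.1) (x q.1) * planeArea e (z' q.1) q.2} := by
        ext q
        exact ⟨fun h => ⟨⟨h.1, h.2⟩, h.3⟩, fun h => ⟨h.1.1, h.1.2, h.2⟩⟩
      rw [this]
      refine ((isClosed_eq ?_ ?_).inter (isClosed_eq ?_ ?_)).inter (isClosed_le ?_ ?_) <;>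
        fun_prop
    have hmem : (t₀, v) ∈ {q : T × X | IsRotated e (z q.1) (z' q.1) (x q.1) q.2} :=
      isClosed_iff_clusterPt.1 hclosed _
        (hv'.clusterPt.mono (le_principal_iff.2 (mem_map.2 (univ_mem' h))))
    exact IsRotated.unique (hz t₀) (hzz t₀) hmem (h t₀)

end IsRotated

end IsRotated

/-- Continuous solutions of a regular analytic equation in finite dimensions are analytic. -/
theorem analyticAt_of_implicit {P E G : Type*} [NormedAddCommGroup P] [NormedSpace ℝ P]
    [FiniteDimensional ℝ P] [NormedAddCommGroup E] [NormedSpace ℝ E] [FiniteDimensional ℝ E]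
    [NormedAddCommGroup G] [NormedSpace ℝ G] [FiniteDimensional ℝ G]
    (hEG : Module.finrank ℝ E = Module.finrank ℝ G) {Φ : P × E → G} {w : P → E} {g : P → G}
    {p : P} (hΦ : AnalyticAt ℝ Φ (p, w p)) (hw : ContinuousAt w p) (hg : AnalyticAt ℝ g p)
    (h : ∀ᶠ q in 𝓝 p, Φ (q, w q) = g q)
    (hinj : ∀ k, fderiv ℝ Φ (p, w p) (0, k) = 0 → k = 0) : AnalyticAt ℝ w p := by
  have := FiniteDimensional.complete ℝ P
  have := FiniteDimensional.complete ℝ E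
  -- Keeping the parameter makes Ψ locally invertible with analytic inverse, and w q is the second
  -- component of that inverse at (q, g q).
  set Ψ : P × E → P × G := fun q => (q.1, Φ q) with hΨ
  set D : P × E →L[ℝ] P × G :=
    (ContinuousLinearMap.fst ℝ P E).prod (fderiv ℝ Φ (p, w p)) with hD
  have hΨa : AnalyticAt ℝ Ψ (p, w p) := analyticAt_fst.prod hΦ
  have hΨd : HasFDerivAt Ψ D (p, w p) :=
    hasFDerivAt_fst.prodMk hΦ.differentiableAt.hasFDerivAt
  have hDinj : Function.Injective (D : P × E →ₗ[ℝ] P × G) := by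
    rw [injective_iff_map_eq_zero]
    rintro ⟨v, k⟩ hvk
    have hv : v = 0 := congrArg Prod.fst hvk
    subst hv
    rw [hinj k (congrArg Prod.snd hvk)]
    rfl
  let D' : (P × E) ≃L[ℝ] P × G := (LinearMap.linearEquivOfInjective (D : P × E →ₗ[ℝ] P × G)
    hDinj (by rw [Module.finrank_prod, Module.finrank_prod, hEG])).toContinuousLinearEquiv
  have hΨd' : HasFDerivAt Ψ (D' : P × E →L[ℝ] P × G) (p, w p) := by
    have hD' : (D' : P × E →L[ℝ] P × G) = D := ContinuousLinearMap.ext fun _ => rfl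
    rwa [hD']
  have hc : ContDiffAt ℝ ⊤ Ψ (p, w p) := hΨa.contDiffAt
  set E' := hc.toOpenPartialHomeomorph Ψ hΨd' (by simp)
  have hmem : (p, w p) ∈ E'.source := hc.mem_toOpenPartialHomeomorph_source hΨd' (by simp)
  have hsymm : AnalyticAt ℝ E'.symm (Ψ (p, w p)) :=
    E'.analyticAt_symm' hmem hΨa hΨd'.fderiv
  have hcont : ContinuousAt (fun q => (q, w q)) p := continuousAt_id.prodMk hw
  have hnear : ∀ᶠ q in 𝓝 p, (q, w q) ∈ E'.source :=
    hcont.eventually_mem (E'.open_source.mem_nhds hmem)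
  have hΨp : Ψ (p, w p) = (p, g p) := by rw [hΨ, ← h.self_of_nhds]
  rw [hΨp] at hsymm
  have hcomp : AnalyticAt ℝ (fun q => (E'.symm (q, g q)).2) p :=
    analyticAt_snd.fun_comp
      (AnalyticAt.fun_comp (f := fun q => (q, g q)) hsymm (analyticAt_id.prod hg))
  refine hcomp.congr ?_
  filter_upwards [h, hnear] with q hq hq'
  have : E'.symm (Ψ (q, w q)) = (q, w q) := E'.left_inv hq'
  rw [hΨ] at this
  simp only [hq] at this
  rw [this]

/-! ### The differential of the norm and tangents to circles. -/

section NormGradient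

variable {X : Type*} [NormedAddCommGroup X] [NormedSpace ℝ X]

theorem IsAnalyticNormedSpace.differentiableAt_norm (hX : IsAnalyticNormedSpace X) {u : X}
    (hu : u ≠ 0) : DifferentiableAt ℝ (fun x : X => ‖x‖) u :=
  (hX u hu).differentiableAt

theorem abs_fderiv_norm_le (u k : X) : |fderiv ℝ (fun x : X => ‖x‖) u k| ≤ ‖k‖ := by
  have h := (fderiv ℝ (fun x : X => ‖x‖) u).le_opNorm k
  have h1 : ‖fderiv ℝ (fun x : X => ‖x‖) u‖ ≤ 1 :=
    norm_fderiv_le_of_lipschitz ℝ (C := 1) lipschitzWith_one_norm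
  rw [Real.norm_eq_abs] at h
  exact h.trans (mul_le_of_le_one_left (norm_nonneg k) h1)

variable (e : X ≃L[ℝ] ℝ × ℝ)

theorem planeArea_eq_zero_of_sameRay {u v : X} (hu : u ≠ 0) (h : SameRay ℝ u v) :
    planeArea e u v = 0 := by
  obtain ⟨a, -, rfl⟩ := h.exists_nonneg_left hu
  rw [planeArea_smul_right, planeArea_self, mul_zero]

/-- In a strictly convex plane, the circles about the origin through two points have parallel
tangents only if the two points lie on a line through the origin. -/
theorem planeArea_eq_zero_of_fderiv_norm_eq_zero [StrictConvexSpace ℝ X]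
    (hX : IsAnalyticNormedSpace X) {u v k : X} (hu : u ≠ 0) (hv : v ≠ 0) (hk : k ≠ 0)
    (hku : fderiv ℝ (fun x : X => ‖x‖) u k = 0) (hkv : fderiv ℝ (fun x : X => ‖x‖) v k = 0) :
    planeArea e u v = 0 := by
  -- Applying the differentials at u and at v to this relation, k drops out; comparing the two
  -- results gives |dN_u(v)| = ‖v‖. So dN_u attains its norm at u and at v or -v, and strict
  -- convexity puts these on one ray.
  have hcyc := planeArea_cyclic e k u v
  have huu := (hX.differentiableAt_norm hu).fderiv_norm_self
  have hvv := (hX.differentiableAt_norm hv).fderiv_norm_self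
  have hA := congrArg (fderiv ℝ (fun x : X => ‖x‖) u) hcyc
  have hB := congrArg (fderiv ℝ (fun x : X => ‖x‖) v) hcyc
  simp only [map_add, map_smul, smul_eq_mul, map_zero, hku, hkv, huu, hvv, mul_zero,
    add_zero] at hA hB
  have ha : planeArea e k u ≠ 0 := by
    rw [Ne, planeArea_eq_zero_iff e hk, Submodule.mem_span_singleton]
    rintro ⟨a, rfl⟩
    rw [map_smul, hku, smul_zero] at huu
    exact hu (norm_eq_zero.1 huu.symm)
  have hbu := abs_fderiv_norm_le v u
  have hbv := abs_fderiv_norm_le u v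
  have hfv : |fderiv ℝ (fun x : X => ‖x‖) u v| = ‖v‖ := by
    refine le_antisymm hbv ?_
    have h1 : |planeArea e k u| * |fderiv ℝ (fun x : X => ‖x‖) u v| =
        |planeArea e v k| * ‖u‖ := by
      have := congrArg abs (eq_neg_of_add_eq_zero_left hA)
      rwa [abs_neg, abs_mul, abs_mul, abs_norm] at this
    have h2 : |planeArea e k u| * ‖v‖ =
        |planeArea e v k| * |fderiv ℝ (fun x : X => ‖x‖) v u| := by
      have := congrArg abs (eq_neg_of_add_eq_zero_left hB)
      rwa [abs_neg, abs_mul, abs_mul, abs_norm] at this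
    have h3 := mul_le_mul_of_nonneg_left hbu (abs_nonneg (planeArea e v k))
    rw [← h2, ← h1] at h3
    exact le_of_mul_le_mul_left h3 (abs_pos.2 ha)
  have hray : ∀ v' : X, fderiv ℝ (fun x : X => ‖x‖) u v' = ‖v'‖ → SameRay ℝ u v' := by
    intro v' hv'
    rw [sameRay_iff_norm_add]
    refine le_antisymm (norm_add_le _ _) ?_
    have h4 := (le_abs_self _).trans (abs_fderiv_norm_le u (u + v'))
    rwa [map_add, huu, hv'] at h4
  rcases abs_choice (fderiv ℝ (fun x : X => ‖x‖) u v) with h | h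
  · exact planeArea_eq_zero_of_sameRay e hu (hray v (by rw [← h, hfv]))
  · have := planeArea_eq_zero_of_sameRay e hu (hray (-v) (by rw [map_neg, ← h, hfv, norm_neg]))
    rwa [← neg_one_smul ℝ v, planeArea_smul_right, neg_one_mul, neg_eq_zero] at this

/-- The gradient of the norm turned by a right angle in the coordinates `e`: a tangent vector
to the circle about the origin through `u`. -/
noncomputable def normTangent (u : X) : X :=
  fderiv ℝ (fun x : X => ‖x‖) u (e.symm (0, 1)) • e.symm (1, 0) -
    fderiv ℝ (fun x : X => ‖x‖) u (e.symm (1, 0)) • e.symm (0, 1)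

theorem fderiv_norm_normTangent (u : X) :
    fderiv ℝ (fun x : X => ‖x‖) u (normTangent e u) = 0 := by
  simp only [normTangent, map_sub, map_smul, smul_eq_mul]
  ring

theorem normTangent_neg (u : X) : normTangent e (-u) = -normTangent e u := by
  have h : fderiv ℝ (fun x : X => ‖x‖) (-u) = -fderiv ℝ (fun x : X => ‖x‖) u := by
    have := fderiv_norm_smul_neg (x := u) (t := -1) (by norm_num)
    rwa [neg_one_smul] at this
  simp only [normTangent, h, neg_apply]
  module

/-- Euler's identity dN_u(u) = ‖u‖, written in coordinates. -/
theorem planeArea_normTangent (hX : IsAnalyticNormedSpace X) {u : X} (hu : u ≠ 0) :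
    planeArea e u (normTangent e u) = -‖u‖ := by
  have huu := (hX.differentiableAt_norm hu).fderiv_norm_self
  have hdec : u = (e u).1 • e.symm (1, 0) + (e u).2 • e.symm (0, 1) := by
    apply e.injective
    ext <;> simp
  have h : fderiv ℝ (fun x : X => ‖x‖) u u =
      (e u).1 * fderiv ℝ (fun x : X => ‖x‖) u (e.symm (1, 0)) +
      (e u).2 * fderiv ℝ (fun x : X => ‖x‖) u (e.symm (0, 1)) := by
    refine (congrArg (fderiv ℝ (fun x : X => ‖x‖) u) hdec).trans ?_
    rw [map_add, map_smul, map_smul, smul_eq_mul, smul_eq_mul]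
  rw [← huu, h]
  simp [planeArea, normTangent]
  ring

theorem normTangent_ne_zero (hX : IsAnalyticNormedSpace X) {u : X} (hu : u ≠ 0) :
    normTangent e u ≠ 0 := by
  intro h
  have := planeArea_normTangent e hX hu
  rw [h, show planeArea e u 0 = 0 by simp [planeArea], eq_comm, neg_eq_zero,
    norm_eq_zero] at this
  exact hu this

theorem analyticAt_normTangent [CompleteSpace X] (hX : IsAnalyticNormedSpace X) {u : X}
    (hu : u ≠ 0) :
    AnalyticAt ℝ (normTangent e) u := by
  have h := (hX u hu).fderiv
  have h' : ∀ k : X, AnalyticAt ℝ (fun u => fderiv ℝ (fun x : X => ‖x‖) u k) u := fun k =>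
    AnalyticAt.fun_comp ((ContinuousLinearMap.apply ℝ ℝ k).analyticAt _) h
  exact ((h' _).smul analyticAt_const).sub ((h' _).smul analyticAt_const)

end NormGradient

/-! ### The parametrised circle as an integral curve. -/

section UnitSpeedCircle

variable {X : Type*} [NormedAddCommGroup X] [NormedSpace ℝ X] {L : ℝ} {z : X}
  {f : AddCircle L → X}

namespace IsUnitSpeedCircle

theorem norm_apply (hf : IsUnitSpeedCircle z f) (t : AddCircle L) : ‖f t‖ = ‖z‖ :=
  mem_sphere_zero_iff_norm.1 (hf.bijective.mapsTo (mem_univ t))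

theorem apply_ne_zero (hf : IsUnitSpeedCircle z f) (hz : z ≠ 0) (t : AddCircle L) : f t ≠ 0 := by
  rw [← norm_pos_iff, hf.norm_apply, norm_pos_iff]; exact hz

theorem exists_apply_eq (hf : IsUnitSpeedCircle z f) {v : X} (hv : ‖v‖ = ‖z‖) :
    ∃ t, f t = v := by
  obtain ⟨t, -, ht⟩ := hf.bijective.surjOn (mem_sphere_zero_iff_norm.2 hv)
  exact ⟨t, ht⟩

theorem injective (hf : IsUnitSpeedCircle z f) : Function.Injective f :=
  injOn_univ.1 hf.bijective.injOn

theorem continuous (hf : IsUnitSpeedCircle z f) : Continuous f := by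
  have h : Continuous fun s : ℝ => f (s : AddCircle L) := hf.analytic.continuous
  exact (QuotientAddGroup.isQuotientMap_mk _).continuous_iff.2 h

/-- The velocity is a multiple of the unit tangent vector, with a constant sign. -/
theorem exists_hasDerivAt (hf : IsUnitSpeedCircle z f) (hz : z ≠ 0)
    (hX : IsAnalyticNormedSpace X) (e : X ≃L[ℝ] ℝ × ℝ) [CompleteSpace X] :
    ∃ σ : ℝ, ∀ s : ℝ, HasDerivAt (fun u : ℝ => f (u : AddCircle L))
      ((σ / ‖normTangent e (f (s : AddCircle L))‖) • normTangent e (f (s : AddCircle L))) s := by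
  set F : ℝ → X := fun u => f (u : AddCircle L) with hF
  have hF0 : ∀ s, F s ≠ 0 := fun s => hf.apply_ne_zero hz _
  have hFz : ∀ s, ‖F s‖ = ‖z‖ := fun s => hf.norm_apply _
  have hzn : ‖z‖ ≠ 0 := norm_ne_zero_iff.2 hz
  have hd : ∀ s, HasDerivAt F (deriv F s) s := fun s =>
    (hf.analytic s (mem_univ s)).differentiableAt.hasDerivAt
  have htan : ∀ s, fderiv ℝ (fun x : X => ‖x‖) (F s) (deriv F s) = 0 := by
    intro s
    have h1 := (hX.differentiableAt_norm (hF0 s)).hasFDerivAt.comp_hasDerivAt s (hd s)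
    have h2 : ((fun x : X => ‖x‖) ∘ F) = fun _ => ‖z‖ := funext hFz
    rw [h2] at h1
    exact h1.unique (hasDerivAt_const s ‖z‖)
  -- The coefficient is read off by taking the area with F s, since the tangent has area -‖z‖ with
  -- it.
  set c : ℝ → ℝ := fun s => -planeArea e (F s) (deriv F s) / ‖z‖ with hc
  have hdc : ∀ s, deriv F s = c s • normTangent e (F s) := by
    intro s
    have h1 := planeArea_cyclic e (F s) (normTangent e (F s)) (deriv F s)
    have h2 := congrArg (fderiv ℝ (fun x : X => ‖x‖) (F s)) h1
    have huu := (hX.differentiableAt_norm (hF0 s)).fderiv_norm_self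
    simp only [map_add, map_smul, smul_eq_mul, htan, fderiv_norm_normTangent, huu,
      mul_zero, add_zero, zero_add] at h2
    have h3 : planeArea e (normTangent e (F s)) (deriv F s) = 0 :=
      (mul_eq_zero.1 (h2.trans (ContinuousLinearMap.map_zero _))).resolve_right (norm_ne_zero_iff.2 (hF0 s))
    rw [h3, planeArea_normTangent e hX (hF0 s), hFz, planeArea_swap e (F s), zero_smul,
      add_zero] at h1
    have h4 : ‖z‖ • deriv F s =
        (-planeArea e (F s) (deriv F s)) • normTangent e (F s) := by
      rw [← sub_eq_zero, ← neg_eq_zero, ← h1]; module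
    rw [hc]
    simp only
    rw [div_eq_inv_mul, mul_smul, ← h4, inv_smul_smul₀ hzn]
  have hKc : Continuous fun s => normTangent e (F s) := by
    rw [continuous_iff_continuousAt]
    exact fun s => ContinuousAt.comp (f := F) (analyticAt_normTangent e hX (hF0 s)).continuousAt
      (hd s).continuousAt
  have hdF : Continuous (deriv F) := (hf.analytic.deriv).continuous
  have hcc : Continuous c := by
    have hFc : Continuous F := hf.analytic.continuous
    exact ((hFc.planeArea e hdF).neg).div_const _
  have hsq : EqOn ((fun s => c s * ‖normTangent e (F s)‖) ^ 2) 1 univ := by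
    intro s _
    have h1 := hf.speed s
    change ‖deriv F s‖ = 1 at h1
    rw [hdc, norm_smul, Real.norm_eq_abs] at h1
    simp only [Pi.pow_apply, Pi.one_apply]
    rw [← sq_abs, abs_mul, abs_norm, h1, one_pow]
  -- Unit speed makes this continuous function ±1-valued, hence constant on ℝ.
  obtain ⟨σ, hσ⟩ : ∃ σ : ℝ, ∀ s, c s * ‖normTangent e (F s)‖ = σ := by
    rcases isPreconnected_univ.eq_one_or_eq_neg_one_of_sq_eq
      (hcc.mul hKc.norm).continuousOn hsq with h | h
    · exact ⟨1, fun s => h (mem_univ s)⟩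
    · exact ⟨-1, fun s => h (mem_univ s)⟩
  refine ⟨σ, fun s => ?_⟩
  have h1 := hd s
  rwa [hdc, show c s = σ / ‖normTangent e (F s)‖ by
    rw [← hσ s, mul_div_cancel_right₀ _
      (norm_ne_zero_iff.2 (normTangent_ne_zero e hX (hF0 s)))]] at h1

/-- Antipodal parameters are mapped to antipodal points of the circle. -/
theorem apply_add_half (hf : IsUnitSpeedCircle z f) (hz : z ≠ 0) (hX : IsAnalyticNormedSpace X)
    (e : X ≃L[ℝ] ℝ × ℝ) [ProperSpace X] (t : AddCircle L) :
    f (t + ((L / 2 : ℝ) : AddCircle L)) = -f t := by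
  obtain ⟨σ, hσ⟩ := hf.exists_hasDerivAt hz hX e
  set V : X → X := fun u => (σ / ‖normTangent e u‖) • normTangent e u with hV
  have hVan : ∀ u : X, u ≠ 0 → AnalyticAt ℝ V u := by
    intro u hu
    have h1 := analyticAt_normTangent e hX hu
    have h2 := normTangent_ne_zero e hX hu
    have h3 : AnalyticAt ℝ (fun u => ‖normTangent e u‖) u :=
      AnalyticAt.fun_comp (hX _ h2) h1
    exact (analyticAt_const.div h3 (norm_ne_zero_iff.2 h2)).smul h1
  have hVneg : ∀ u, V (-u) = -V u := fun u => by
    simp only [hV, normTangent_neg, norm_neg, smul_neg]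
  obtain ⟨K, hK⟩ : ∃ K, LipschitzOnWith K V (Metric.sphere 0 ‖z‖) := by
    refine LocallyLipschitzOn.exists_lipschitzOnWith_of_compact (isCompact_sphere 0 ‖z‖) ?_
    intro u hu
    have hu0 : u ≠ 0 := by
      rw [← norm_pos_iff, mem_sphere_zero_iff_norm.1 hu, norm_pos_iff]; exact hz
    obtain ⟨K, A, hA, hKA⟩ := (hVan u hu0).contDiffAt.exists_lipschitzOnWith (𝕂 := ℝ)
    exact ⟨K, A, mem_nhdsWithin_of_mem_nhds hA, hKA⟩
  obtain ⟨t₀, ht₀⟩ := hf.exists_apply_eq (norm_neg z)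
  obtain ⟨c, rfl⟩ := QuotientAddGroup.mk_surjective t₀
  -- As V is odd, both sides solve u' = V(u) on the sphere, starting from -z.
  have hode : (fun s : ℝ => f ((s + c : ℝ) : AddCircle L)) = fun s : ℝ => -f (s : AddCircle L) := by
    refine ODE_solution_unique_univ (v := fun _ => V) (s := fun _ => Metric.sphere 0 ‖z‖)
      (K := K) (t₀ := 0) (fun _ => hK) (fun s => ⟨?_, ?_⟩) (fun s => ⟨?_, ?_⟩) ?_
    · exact (hσ (s + c)).comp_add_const s c
    · exact mem_sphere_zero_iff_norm.2 (hf.norm_apply _)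
    · rw [hVneg]
      exact (hσ s).neg
    · rw [mem_sphere_zero_iff_norm, norm_neg, hf.norm_apply]
    · simp only [zero_add, AddCircle.coe_zero, hf.map_zero]
      exact ht₀
  have hadd : ∀ t : AddCircle L, f (t + (c : AddCircle L)) = -f t := by
    intro t
    obtain ⟨s, rfl⟩ := QuotientAddGroup.mk_surjective t
    exact congrFun hode s
  have hfc : f (c : AddCircle L) = -z := ht₀
  have h2c : ((c + c : ℝ) : AddCircle L) = 0 := by
    apply hf.injective
    rw [AddCircle.coe_add, hadd, hf.map_zero, hfc, neg_neg]
  have hc0 : (c : AddCircle L) ≠ 0 := by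
    intro h0
    rw [h0, hf.map_zero, eq_neg_iff_add_eq_zero, ← two_smul ℝ] at hfc
    exact hz ((smul_eq_zero.1 hfc).resolve_left two_ne_zero)
  -- The class of c is non-zero with double zero, so 2c is an odd multiple of L.
  have hhalf : ((L / 2 : ℝ) : AddCircle L) = (c : AddCircle L) := by
    obtain ⟨n, hn⟩ := AddCircle.coe_eq_zero_iff L |>.1 h2c
    rw [zsmul_eq_mul] at hn
    rcases Int.even_or_odd' n with ⟨m, rfl | rfl⟩
    · refine absurd ((AddCircle.coe_eq_zero_iff L).2 ⟨m, ?_⟩) hc0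
      rw [zsmul_eq_mul]
      push_cast at hn
      linarith
    · rw [eq_comm, ← sub_eq_zero, ← AddCircle.coe_sub]
      refine (AddCircle.coe_eq_zero_iff L).2 ⟨m, ?_⟩
      rw [zsmul_eq_mul]
      push_cast at hn
      linarith
  rw [hhalf, hadd]

end IsUnitSpeedCircle

end UnitSpeedCircle

/-! ### Rotations along the circle and their properties. -/

section ZRotation

variable {X : Type*} [NormedAddCommGroup X] [NormedSpace ℝ X] {L : ℝ} {z : X}
  {f : AddCircle L → X} {r : X × AddCircle L → X}

namespace IsZRotation

/-- By connectedness of the circle, a `z`-rotation keeps every point on its side. -/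
theorem isRotated [StrictConvexSpace ℝ X] (hr : IsZRotation z f r) (hf : IsUnitSpeedCircle z f)
    (hz : z ≠ 0) (e : X ≃L[ℝ] ℝ × ℝ) (x : X) (t : AddCircle L) :
    IsRotated e z (f t) x (r (x, t)) := by
  have hsub : ∀ t, ‖r (x, t) - f t‖ = ‖x - z‖ := fun t => by
    rw [← hr.apply_self, hr.norm_sub_eq]
  refine ⟨hr.norm_eq x t, hsub t, ?_⟩
  obtain ⟨s, rfl⟩ := QuotientAddGroup.mk_surjective t
  set g : ℝ → ℝ := fun s => planeArea e z x * planeArea e (f (s : AddCircle L))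
    (r (x, (s : AddCircle L))) with hg
  have hgc : Continuous g := by
    have h1 : Continuous fun s : ℝ => (s : AddCircle L) := AddCircle.continuous_mk' L
    exact continuous_const.mul ((hf.continuous.comp h1).planeArea e
      (hr.continuous.comp (continuous_const.prodMk h1)))
  change 0 ≤ g s
  by_contra! hneg
  have h0 : 0 ≤ g 0 := by
    simp only [hg, AddCircle.coe_zero, hf.map_zero, hr.apply_zero]
    exact mul_self_nonneg _
  -- At a zero of g the data would form a rotated configuration, for which the area product is
  -- strictly positive.
  obtain ⟨u, -, hu⟩ := isPreconnected_univ.intermediate_value (mem_univ s) (mem_univ 0)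
    hgc.continuousOn ⟨hneg.le, h0⟩
  have hpos := IsRotated.planeArea_pos hz (hf.norm_apply u)
    ⟨hr.norm_eq x u, hsub u, hu.ge⟩ (left_ne_zero_of_mul hneg.ne)
  exact hpos.ne' hu

theorem unique [StrictConvexSpace ℝ X] {r' : X × AddCircle L → X} (hr : IsZRotation z f r)
    (hr' : IsZRotation z f r') (hf : IsUnitSpeedCircle z f) (hz : z ≠ 0)
    (e : X ≃L[ℝ] ℝ × ℝ) : r = r' :=
  funext fun p => (hr.isRotated hf hz e p.1 p.2).unique hz (hf.norm_apply p.2)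
    (hr'.isRotated hf hz e p.1 p.2)

theorem analyticOnNhd [StrictConvexSpace ℝ X] [FiniteDimensional ℝ X] (hr : IsZRotation z f r)
    (hf : IsUnitSpeedCircle z f) (hz : z ≠ 0) (hX : IsAnalyticNormedSpace X)
    (e : X ≃L[ℝ] ℝ × ℝ) :
    AnalyticOnNhd ℝ (fun p : X × ℝ => r (p.1, (p.2 : AddCircle L)))
      (((Submodule.span ℝ {z} : Submodule ℝ X) : Set X)ᶜ ×ˢ univ) := by
  rintro ⟨x, s⟩ ⟨hx, -⟩
  rw [mem_compl_iff, SetLike.mem_coe, ← planeArea_eq_zero_iff e hz] at hx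
  have hrot := hr.isRotated hf hz e x s
  have hft := hf.apply_ne_zero hz (s : AddCircle L)
  have harea : planeArea e (f (s : AddCircle L)) (r (x, (s : AddCircle L))) ≠ 0 :=
    right_ne_zero_of_mul (hrot.planeArea_pos hz (hf.norm_apply _) hx).ne'
  have hne : ∀ {u v : X}, planeArea e u v ≠ 0 → v ≠ 0 ∧ v - u ≠ 0 := by
    intro u v huv
    constructor
    · rintro rfl; simp [planeArea] at huv
    · intro h; rw [sub_eq_zero.1 h] at huv; simp at huv
  obtain ⟨hx0, hxz⟩ := hne hx
  obtain ⟨hw0, hwf⟩ := hne harea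
  have hsnd : AnalyticAt ℝ (fun q : (X × ℝ) × X => f (q.1.2 : AddCircle L))
      ((x, s), r (x, (s : AddCircle L))) :=
    AnalyticAt.fun_comp (f := fun q : (X × ℝ) × X => q.1.2)
      (g := fun s : ℝ => f (s : AddCircle L)) (hf.analytic s (mem_univ s))
      (analyticAt_snd.fun_comp analyticAt_fst)
  have hdiff : AnalyticAt ℝ (fun q : (X × ℝ) × X => q.2 - f (q.1.2 : AddCircle L))
      ((x, s), r (x, (s : AddCircle L))) := analyticAt_snd.sub hsnd
  have hΦ₁ : AnalyticAt ℝ (fun q : (X × ℝ) × X => ‖q.2‖) ((x, s), r (x, (s : AddCircle L))) :=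
    AnalyticAt.fun_comp (f := fun q : (X × ℝ) × X => q.2) (g := fun v : X => ‖v‖)
      (hX _ hw0) analyticAt_snd
  have hΦ₂ : AnalyticAt ℝ (fun q : (X × ℝ) × X => ‖q.2 - f (q.1.2 : AddCircle L)‖)
      ((x, s), r (x, (s : AddCircle L))) :=
    AnalyticAt.fun_comp (g := fun v : X => ‖v‖) (hX _ hwf) hdiff
  have hfst : AnalyticAt ℝ (fun q : X × ℝ => q.1) (x, s) := analyticAt_fst
  have hcoe : Continuous fun s : ℝ => (s : AddCircle L) := AddCircle.continuous_mk' L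
  refine analyticAt_of_implicit (G := ℝ × ℝ)
    (Φ := fun q => (‖q.2‖, ‖q.2 - f (q.1.2 : AddCircle L)‖)) (g := fun q => (‖q.1‖, ‖q.1 - z‖)) e.toLinearEquiv.finrank_eq (hΦ₁.prod hΦ₂) ?_ ?_ ?_ ?_
  · exact (hr.continuous.comp (continuous_fst.prodMk (hcoe.comp continuous_snd))).continuousAt
  · exact (AnalyticAt.fun_comp (g := fun v : X => ‖v‖) (hX _ hx0) hfst).prod
      (AnalyticAt.fun_comp (g := fun v : X => ‖v‖) (hX _ hxz) (hfst.sub analyticAt_const))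
  · exact Eventually.of_forall fun q => Prod.ext (hr.norm_eq _ _)
      (hr.isRotated hf hz e q.1 q.2).norm_sub_eq
  -- A kernel vector is tangent at w to the circles about 0 and f s; if non-zero, it makes w and w -
  -- f s collinear, placing w on the excluded line.
  · intro k hk
    by_contra hk0
    set w := r (x, (s : AddCircle L)) with hw
    have hline : HasFDerivAt (fun v : X => (((x, s), v) : (X × ℝ) × X))
        (ContinuousLinearMap.inr ℝ (X × ℝ) X) w := hasFDerivAt_prodMk_right (x, s) w
    have hcomp := ((hΦ₁.prod hΦ₂).differentiableAt.hasFDerivAt).comp w hline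
    have hdir : HasFDerivAt (fun v : X => (‖v‖, ‖v - f (s : AddCircle L)‖))
        ((fderiv ℝ (fun v : X => ‖v‖) w).prod
          (fderiv ℝ (fun v : X => ‖v‖) (w - f (s : AddCircle L)))) w := by
      refine (hX.differentiableAt_norm hw0).hasFDerivAt.prodMk ?_
      exact (hX.differentiableAt_norm hwf).hasFDerivAt.comp w
        ((hasFDerivAt_id w).sub_const (f (s : AddCircle L)))
    have heq := congrArg (fun A : X →L[ℝ] ℝ × ℝ => A k) (hcomp.unique hdir)
    have heq' : (0 : ℝ × ℝ) = (fderiv ℝ (fun v : X => ‖v‖) w k,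
        fderiv ℝ (fun v : X => ‖v‖) (w - f (s : AddCircle L)) k) := hk.symm.trans heq
    have hpar := planeArea_eq_zero_of_fderiv_norm_eq_zero e hX hw0 hwf hk0
      (congrArg Prod.fst heq').symm (congrArg Prod.snd heq').symm
    rw [planeArea_sub_right, planeArea_self, zero_sub, neg_eq_zero, planeArea_swap,
      neg_eq_zero] at hpar
    exact harea hpar

end IsZRotation

theorem IsUnitSpeedCircle.exists_isZRotation [StrictConvexSpace ℝ X] [ProperSpace X]
    (hf : IsUnitSpeedCircle z f) (hz : z ≠ 0) (e : X ≃L[ℝ] ℝ × ℝ) :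
    ∃ r : X × AddCircle L → X, IsZRotation z f r := by
  choose r hr using fun p : X × AddCircle L =>
    IsRotated.exists_isRotated e hz (hf.norm_apply p.2) p.1
  have hself : ∀ t, r (z, t) = f t := fun t =>
    (hr (z, t)).unique hz (hf.norm_apply t) ⟨hf.norm_apply t, by simp, by simp⟩
  refine ⟨r, ?_, hself, fun x => ?_, fun x t => (hr (x, t)).norm_eq, fun x t => ?_⟩
  · exact IsRotated.continuous (fun _ => hz) (fun p => hf.norm_apply p.2) continuous_const
      (hf.continuous.comp continuous_snd) continuous_fst hr
  · refine (hr (x, 0)).unique hz (hf.norm_apply 0) ⟨rfl, by rw [hf.map_zero], ?_⟩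
    rw [hf.map_zero]
    exact mul_self_nonneg _
  · rw [hself]
    exact (hr (x, t)).norm_sub_eq

namespace IsZRotation

variable [StrictConvexSpace ℝ X]

theorem notMem_span_and_sameSide_iff (hr : IsZRotation z f r) (hf : IsUnitSpeedCircle z f)
    (hz : z ≠ 0) (e : X ≃L[ℝ] ℝ × ℝ) {x y : X} (hx : x ∉ Submodule.span ℝ {z})
    (hy : y ∉ Submodule.span ℝ {z}) (t : AddCircle L) :
    r (x, t) ∉ Submodule.span ℝ {f t} ∧ r (y, t) ∉ Submodule.span ℝ {f t} ∧
      (SameSide z x y ↔ SameSide (f t) (r (x, t)) (r (y, t))) := by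
  have hft := hf.apply_ne_zero hz t
  rw [← planeArea_eq_zero_iff e hz] at hx hy
  have h1 := (hr.isRotated hf hz e x t).planeArea_pos hz (hf.norm_apply t) hx
  have h2 := (hr.isRotated hf hz e y t).planeArea_pos hz (hf.norm_apply t) hy
  rw [← planeArea_eq_zero_iff e hft, ← planeArea_eq_zero_iff e hft,
    sameSide_iff_planeArea e hz, sameSide_iff_planeArea e hft]
  refine ⟨right_ne_zero_of_mul h1.ne', right_ne_zero_of_mul h2.ne', ?_⟩
  exact pos_iff_pos_of_mul_pos (by rw [mul_mul_mul_comm]; exact mul_pos h1 h2)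

/-- The inverse rotates f t back to z, by `IsRotated.symm`, and is continuous for the same reason as
r. -/
theorem isHomeomorph [ProperSpace X] (hr : IsZRotation z f r) (hf : IsUnitSpeedCircle z f)
    (hz : z ≠ 0) (e : X ≃L[ℝ] ℝ × ℝ) (t : AddCircle L) :
    IsHomeomorph fun x : X => r (x, t) := by
  have hft := hf.apply_ne_zero hz t
  have hzf : ‖z‖ = ‖f t‖ := (hf.norm_apply t).symm
  choose q hq using IsRotated.exists_isRotated e hft hzf
  have hrot := fun x => hr.isRotated hf hz e x t
  exact Homeomorph.isHomeomorph
    { toFun := fun x => r (x, t)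
      invFun := q
      left_inv := fun x => (hq _).unique hft hzf (hrot x).symm
      right_inv := fun w => (hrot _).unique hz hzf.symm (hq w).symm
      continuous_toFun := hr.continuous.comp (continuous_id.prodMk continuous_const)
      continuous_invFun := IsRotated.continuous (fun _ => hft) (fun _ => hzf) continuous_const
        continuous_const continuous_id hq }

/-- By `IsRotated.exchange`, r (x, t) determines f t as the position of z when x is moved there;
hence bijectivity, and compactness does the rest. -/
theorem exists_homeomorph_sphere [Fact (0 < L)] (hr : IsZRotation z f r)
    (hf : IsUnitSpeedCircle z f) (hz : z ≠ 0) (e : X ≃L[ℝ] ℝ × ℝ) {x : X} (hx : x ≠ 0) :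
    ∃ φ : AddCircle L ≃ₜ Metric.sphere (0 : X) ‖x‖, ∀ t, (φ t : X) = r (x, t) := by
  have hrot := fun t => hr.isRotated hf hz e x t
  set g : AddCircle L → Metric.sphere (0 : X) ‖x‖ := fun t =>
    ⟨r (x, t), mem_sphere_zero_iff_norm.2 (hr.norm_eq x t)⟩ with hg
  have hgc : Continuous g :=
    (hr.continuous.comp (continuous_const.prodMk continuous_id)).subtype_mk _
  have hbij : Function.Bijective g := by
    constructor
    · intro s t hst
      have hst' : r (x, s) = r (x, t) := congrArg Subtype.val hst
      have h1 := (hrot s).exchange (hf.norm_apply s)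
      rw [hst'] at h1
      exact hf.injective (h1.unique hx (hr.norm_eq x t) ((hrot t).exchange (hf.norm_apply t)))
    · rintro ⟨w, hw⟩
      have hw' := mem_sphere_zero_iff_norm.1 hw
      obtain ⟨z', hz'⟩ := IsRotated.exists_isRotated e hx hw' z
      obtain ⟨t, rfl⟩ := hf.exists_apply_eq hz'.norm_eq
      exact ⟨t, Subtype.ext ((hrot t).unique hz (hf.norm_apply t) (hz'.exchange hw'))⟩
  exact ⟨Continuous.homeoOfEquivCompactToT2 (f := Equiv.ofBijective g hbij) hgc, fun t => rfl⟩

theorem apply_add_half [ProperSpace X] (hr : IsZRotation z f r) (hf : IsUnitSpeedCircle z f)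
    (hz : z ≠ 0) (hX : IsAnalyticNormedSpace X) (e : X ≃L[ℝ] ℝ × ℝ) (x : X) (t : AddCircle L) :
    r (x, t + ((L / 2 : ℝ) : AddCircle L)) = -r (x, t) := by
  have h := hr.isRotated hf hz e x (t + ((L / 2 : ℝ) : AddCircle L))
  rw [hf.apply_add_half hz hX e] at h
  exact h.unique hz (by rw [norm_neg, hf.norm_apply]) (hr.isRotated hf hz e x t).neg

end IsZRotation

end ZRotation

theorem theoremt {X : Type*} [NormedAddCommGroup X] [NormedSpace ℝ X]
    (hdim : Module.finrank ℝ X = 2) (hX : IsAnalyticNormedSpace X)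
    (z : X) (hz : z ≠ 0) (L : ℝ) (hL : 0 < L)
    (f : AddCircle L → X) (hf : IsUnitSpeedCircle z f) :
    (∃! r : X × AddCircle L → X, IsZRotation z f r) ∧
    ∀ r : X × AddCircle L → X, IsZRotation z f r →
      -- analyticity off the line through `0` and `z`
      AnalyticOnNhd ℝ (fun p : X × ℝ => r (p.1, (p.2 : AddCircle L)))
        (((Submodule.span ℝ {z} : Submodule ℝ X) : Set X)ᶜ ×ˢ Set.univ) ∧
      -- half-planes are preserved
      (∀ x ∉ Submodule.span ℝ {z}, ∀ y ∉ Submodule.span ℝ {z}, ∀ t : AddCircle L,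
        r (x, t) ∉ Submodule.span ℝ {f t} ∧ r (y, t) ∉ Submodule.span ℝ {f t} ∧
        (SameSide z x y ↔ SameSide (f t) (r (x, t)) (r (y, t)))) ∧
      -- each time map is a homeomorphism of the plane
      (∀ t : AddCircle L, IsHomeomorph (fun x : X => r (x, t))) ∧
      -- each orbit is a homeomorphism onto a circle
      (∀ x : X, x ≠ 0 → ∃ e : AddCircle L ≃ₜ Metric.sphere (0 : X) ‖x‖,
        ∀ t : AddCircle L, (e t : X) = r (x, t)) ∧
      -- antipodal times give opposite points
      (∀ (x : X) (t : AddCircle L), r (x, t + ((L / 2 : ℝ) : AddCircle L)) = -r (x, t)) := by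
  have : Fact (0 < L) := ⟨hL⟩
  have : FiniteDimensional ℝ X := FiniteDimensional.of_finrank_pos (by omega)
  have : ProperSpace X := FiniteDimensional.proper_real X
  have : StrictConvexSpace ℝ X := hX.strictConvexSpace
  let e : X ≃L[ℝ] ℝ × ℝ := ContinuousLinearEquiv.ofFinrankEq (by simp [hdim])
  obtain ⟨r₀, hr₀⟩ := hf.exists_isZRotation hz e
  refine ⟨⟨r₀, hr₀, fun r hr => hr.unique hr₀ hf hz e⟩, fun r hr => ⟨?_, ?_, ?_, ?_, ?_⟩⟩
  · exact hr.analyticOnNhd hf hz hX e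
  · exact fun x hx y hy t => hr.notMem_span_and_sameSide_iff hf hz e hx hy t
  · exact hr.isHomeomorph hf hz e
  · exact fun x hx => hr.exists_homeomorph_sphere hf hz e hx
  · exact hr.apply_add_half hf hz hX e
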